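/- A star of size $k$ is a complete bipartite graph with a single vertex (the centre) on one side and $k$ vertices (the leaves) on the other. For a natural number $\ell$, an $\mathcal S_\ell$-factor of a graph $G$ is a collection of pairwise vertex-disjoint (not necessarily induced) subgraphs of $G$, each of which is a star of size at least $\ell$, that together cover all vertices of $G$. Theorem. There exist constants $d_0, C \in \mathbb{N}$ such that every finite graph $G$ with minimum degree $d \ge d_0$ contains an $\mathcal S_\ell$-factor for some natural number $\ell \ge \sqrt d - C\, d^{1/4}\sqrt{\log d}$. -/

import Mathlib

namespace StarFactor

/-- `H` is a star of size `k`: a complete bipartite graph with a single vertex (the centre) on one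
side and `k` vertices (the leaves) on the other. -/
def IsStar {W : Type*} (H : SimpleGraph W) (k : ℕ) : Prop :=
  Nonempty (H ≃g completeBipartiteGraph (Fin 1) (Fin k))

/-- `P` is an `S_ℓ`-packing of `G`: a collection of pairwise vertex-disjoint (not necessarily
induced) subgraphs of `G`, each of which is a star of size at least `ℓ`. -/
def IsStarPacking {V : Type*} (G : SimpleGraph V) (ℓ : ℕ) (P : Set G.Subgraph) : Prop :=
  (∀ H ∈ P, ∃ k : ℕ, ℓ ≤ k ∧ IsStar H.coe k) ∧
    P.Pairwise fun H H' => Disjoint H.verts H'.verts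

/-- `G` contains an `S_ℓ`-factor: an `S_ℓ`-packing that covers all the vertices of `G`. -/
def HasStarFactor {V : Type*} (G : SimpleGraph V) (ℓ : ℕ) : Prop :=
  ∃ P : Set G.Subgraph, IsStarPacking G ℓ P ∧ ∀ v : V, ∃ H ∈ P, v ∈ H.verts

end StarFactor

/-! Pass to an edge-minimal subgraph of minimum degree at least `d`. Every edge then has an end of
degree exactly `d`; let `A` be the set of these vertices, so that the vertices outside `A` are
independent. Let `N` be the vertices of `A` with fewer than `d / 2` neighbours in `A`, and `B` those
of `A` with more than `(1 - ε) d` neighbours in `N`; these are disjoint.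

Colour the vertices at random: colour 1 (candidate centre) with probability `p`, colour 2 (reserved
leaf) with probability `ε`, else 0. The local lemma makes all local counts close to expectation
(`exists_balanced_colouring`). The centres `X` are the vertices outside `N` that have colour 1 or
degree above `d ^ 2`. Each sees many vertices of `F`, the colour 2 part of `A`, while each vertex of
`F` sees few centres, so a weighted Hall condition (`exists_disjoint_subsets_of_weight`) gives the
centres disjoint sets of `ℓ` leaves in `F`.

With `P = A \ B`, every vertex of `P \ X` is adjacent to `X`, and every other vertex outside `X` is
adjacent to `X` or has at least `m = (1 - 7 ε) d` neighbours in `Z = P \ (F ∪ X)`.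
`hasStarFactor_of_partial` finishes from there: take a maximal family of `ℓ`-stars centred in `Z`
with leaves outside `P`. The vertices `W` still not adjacent to any centre send at least `m` edges
each to `Z`, while an unused vertex of `Z` receives at most `ℓ`. As `ℓ ^ 2 ≤ m`, Hall makes `W`
centres of disjoint `ℓ`-stars with leaves in `Z`. All remaining vertices are attached to an adjacent
centre. The bound `ℓ ^ 2 ≤ m` is what yields `√d`, with `ε` of order `d ^ (-1/4) √(log d)`. -/

namespace StarFactor

/-! ### Finite weighted spaces and the local lemma. -/

/-- The total weight of the set `S`. -/
noncomputable def mass {Ω : Type*} [Fintype Ω] (w : Ω → ℝ) (S : Set Ω) : ℝ :=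
  ∑ ω, S.indicator w ω

section Mass

variable {Ω : Type*} [Fintype Ω] {w : Ω → ℝ}

lemma mass_mono (hw : ∀ ω, 0 ≤ w ω) {S T : Set Ω} (h : S ⊆ T) : mass w S ≤ mass w T :=
  Finset.sum_le_sum fun ω _ => Set.indicator_le_indicator_of_subset h hw ω

lemma mass_nonneg (hw : ∀ ω, 0 ≤ w ω) (S : Set Ω) : 0 ≤ mass w S :=
  Finset.sum_nonneg fun ω _ => Set.indicator_nonneg (fun x _ => hw x) ω

lemma mass_empty : mass w (∅ : Set Ω) = 0 := by simp [mass]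

lemma mass_union_le (hw : ∀ ω, 0 ≤ w ω) (S T : Set Ω) :
    mass w (S ∪ T) ≤ mass w S + mass w T := by
  unfold mass
  rw [← Finset.sum_add_distrib]
  refine Finset.sum_le_sum fun ω _ => ?_
  have := hw ω
  by_cases h1 : ω ∈ S <;> by_cases h2 : ω ∈ T <;> simp [h1, h2, this]

lemma mass_le_of_forall_one_le (hw : ∀ ω, 0 ≤ w ω) {S : Set Ω} (f : Ω → ℝ)
    (hf : ∀ ω, 0 ≤ f ω) (hS : ∀ ω ∈ S, 1 ≤ f ω) : mass w S ≤ ∑ ω, w ω * f ω := by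
  refine Finset.sum_le_sum fun ω _ => ?_
  by_cases h : ω ∈ S
  · rw [Set.indicator_of_mem h]
    exact le_mul_of_one_le_right (hw ω) (hS ω h)
  · rw [Set.indicator_of_notMem h]
    exact mul_nonneg (hw ω) (hf ω)

lemma mass_sdiff_add_inter (S T : Set Ω) :
    mass w (S \ T) + mass w (T ∩ S) = mass w S := by
  unfold mass
  rw [← Finset.sum_add_distrib]
  refine Finset.sum_congr rfl fun ω _ => ?_
  by_cases h1 : ω ∈ S <;> by_cases h2 : ω ∈ T <;> simp [h1, h2]

/-- The outcomes that avoid all the events with index in `T`. -/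
def avoiding {ι : Type*} (Ev : ι → Set Ω) (T : Finset ι) : Set Ω := {ω | ∀ j ∈ T, ω ∉ Ev j}

lemma avoiding_anti {ι : Type*} (Ev : ι → Set Ω) {S T : Finset ι} (h : S ⊆ T) :
    avoiding Ev T ⊆ avoiding Ev S := fun _ hω j hj => hω j (h hj)

lemma mass_avoiding_union {ι : Type*} [DecidableEq ι] (hw : ∀ ω, 0 ≤ w ω) (Ev : ι → Set Ω)
    (S T : Finset ι) :
    mass w (avoiding Ev T) - ∑ j ∈ S, mass w (Ev j ∩ avoiding Ev T)
      ≤ mass w (avoiding Ev (S ∪ T)) := by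
  induction S using Finset.induction_on with
  | empty => simp
  | insert a S ha ih =>
    rw [Finset.sum_insert ha]
    have h1 : avoiding Ev (insert a S ∪ T) = avoiding Ev (S ∪ T) \ Ev a := by
      ext ω
      simp only [avoiding, Finset.mem_union, Finset.mem_insert, Set.mem_ofPred_eq, Set.mem_sdiff]
      constructor
      · intro h
        exact ⟨fun j hj => h j (by tauto), h a (by tauto)⟩
      · rintro ⟨h, h'⟩ j ((rfl | hj) | hj)
        · exact h'
        · exact h j (Or.inl hj)
        · exact h j (Or.inr hj)
    have h2 := mass_sdiff_add_inter (w := w) (avoiding Ev (S ∪ T)) (Ev a)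
    have h3 : mass w (Ev a ∩ avoiding Ev (S ∪ T)) ≤ mass w (Ev a ∩ avoiding Ev T) :=
      mass_mono hw (Set.inter_subset_inter_right _ (avoiding_anti Ev Finset.subset_union_right))
    rw [h1]
    linarith

/-- The symmetric Lovász local lemma. -/
theorem exists_forall_notMem_of_local {ι : Type*} [Fintype ι] [DecidableEq ι]
    (hw : ∀ ω, 0 ≤ w ω) (hpos : 0 < ∑ ω, w ω) (Ev : ι → Set Ω) (Γ : ι → Finset ι) {Δ q : ℝ}
    (hΔ : 1 ≤ Δ) (hq : 0 ≤ q) (hΓ : ∀ i, ((Γ i).card : ℝ) ≤ Δ) (hΔq : 4 * Δ * q ≤ 1)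
    (hloc : ∀ i (T : Finset ι), Disjoint T (Γ i) →
      mass w (Ev i ∩ avoiding Ev T) ≤ q * mass w (avoiding Ev T)) :
    ∃ ω, ∀ i, ω ∉ Ev i := by
  have key : ∀ (n : ℕ) (S : Finset ι), S.card ≤ n → ∀ i,
      mass w (Ev i ∩ avoiding Ev S) ≤ 2 * q * mass w (avoiding Ev S) := by
    intro n
    induction n with
    | zero =>
      intro S hS i
      have h0 : S = ∅ := by simpa using hS
      subst h0
      have := hloc i ∅ (by simp)
      nlinarith [mul_nonneg hq (mass_nonneg hw (avoiding Ev ∅))]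
    | succ n ih =>
      intro S hS i
      have hm := mass_nonneg hw (avoiding Ev (S \ Γ i))
      have h1 : mass w (Ev i ∩ avoiding Ev S) ≤ q * mass w (avoiding Ev (S \ Γ i)) :=
        (mass_mono hw (Set.inter_subset_inter_right _
          (avoiding_anti Ev Finset.sdiff_subset))).trans (hloc i _ Finset.sdiff_disjoint)
      by_cases hne : S ∩ Γ i = ∅
      · have : S \ Γ i = S := by
          rw [Finset.sdiff_eq_self_iff_disjoint]
          exact Finset.disjoint_iff_inter_eq_empty.2 hne
        rw [this] at h1 hm
        nlinarith [mul_nonneg hq hm]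
      · have hcard : (S \ Γ i).card ≤ n := by
          have h2 := Finset.card_sdiff_add_card_inter S (Γ i)
          have h3 : 0 < (S ∩ Γ i).card := Finset.card_pos.2 (Finset.nonempty_iff_ne_empty.2 hne)
          omega
        have h2 := mass_avoiding_union hw Ev (S ∩ Γ i) (S \ Γ i)
        have h3 : (S ∩ Γ i) ∪ (S \ Γ i) = S := by
          ext x; simp only [Finset.mem_union, Finset.mem_inter, Finset.mem_sdiff]; tauto
        rw [h3] at h2
        -- By induction the events of `S ∩ Γ i` remove at most `2 Δ q ≤ 1/2` of the mass avoiding `S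
        -- \ Γ i`, so the bound `q` at most doubles.
        have h4 : ∑ j ∈ S ∩ Γ i, mass w (Ev j ∩ avoiding Ev (S \ Γ i))
            ≤ Δ * (2 * q * mass w (avoiding Ev (S \ Γ i))) := by
          refine (Finset.sum_le_card_nsmul _ _ _ fun j _ => ih _ hcard j).trans ?_
          rw [nsmul_eq_mul]
          refine mul_le_mul_of_nonneg_right ?_ (by positivity)
          exact (Nat.cast_le.2 (Finset.card_le_card Finset.inter_subset_right)).trans (hΓ i)
        have h5 : 4 * Δ * q * mass w (avoiding Ev (S \ Γ i)) ≤
            mass w (avoiding Ev (S \ Γ i)) := mul_le_of_le_one_left hm hΔq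
        have h6 : mass w (avoiding Ev (S \ Γ i)) ≤ 2 * mass w (avoiding Ev S) := by linarith
        nlinarith [mul_le_mul_of_nonneg_left h6 hq]
  have hq4 : 4 * q ≤ 1 := by nlinarith
  have pos : ∀ S : Finset ι, 0 < mass w (avoiding Ev S) := by
    intro S
    induction S using Finset.induction_on with
    | empty => simpa [mass, avoiding] using hpos
    | insert a S ha ih =>
      have h1 := mass_avoiding_union hw Ev {a} S
      have h2 := key _ S le_rfl a
      rw [Finset.sum_singleton, ← Finset.insert_eq] at h1
      nlinarith
  by_contra! hcon
  have : avoiding Ev Finset.univ = ∅ := by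
    ext ω
    obtain ⟨i, hi⟩ := hcon ω
    simp only [avoiding, Finset.mem_univ, Set.mem_ofPred_eq, Set.mem_empty_iff_false, iff_false]
    exact fun h => h i trivial hi
  have h := pos Finset.univ
  rw [this, mass_empty] at h
  exact lt_irrefl _ h

end Mass

/-! ### Independent random colourings: independence and tail bounds. -/

section Product

variable {ι κ : Type*} [Fintype ι] [DecidableEq ι] [Fintype κ] [DecidableEq κ] {μ : κ → ℝ}

/-- The product weight on colourings. -/
def prodWeight (ι : Type*) [Fintype ι] {κ : Type*} (μ : κ → ℝ) (ω : ι → κ) : ℝ := ∏ i, μ (ω i)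

lemma prodWeight_nonneg (hμ : ∀ c, 0 ≤ μ c) (ω : ι → κ) : 0 ≤ prodWeight ι μ ω :=
  Finset.prod_nonneg fun _ _ => hμ _

lemma sum_prodWeight_mul (μ : κ → ℝ) (f : ι → κ → ℝ) :
    ∑ ω : ι → κ, prodWeight ι μ ω * ∏ i, f i (ω i) = ∏ i, ∑ c, μ c * f i c := by
  rw [Finset.prod_univ_sum, Fintype.piFinset_univ]
  simp [prodWeight, Finset.prod_mul_distrib]

lemma sum_prodWeight (hμ : ∑ c, μ c = 1) : ∑ ω : ι → κ, prodWeight ι μ ω = 1 := by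
  have := sum_prodWeight_mul (ι := ι) μ (fun _ _ => 1)
  simpa [hμ] using this

/-- Fubini: splitting the coordinates by `I` factorises both the weight and the indicator of `A ∩
B`. The fixed colouring `ω₀` only fills in the coordinates on which a set does not depend. -/
lemma mass_inter_of_disjoint_support (hμ : ∑ c, μ c = 1) {A B : Set (ι → κ)} (I : ι → Prop)
    [DecidablePred I]
    (hA : ∀ ω ω' : ι → κ, (∀ i, I i → ω i = ω' i) → ω ∈ A → ω' ∈ A)
    (hB : ∀ ω ω' : ι → κ, (∀ i, ¬ I i → ω i = ω' i) → ω ∈ B → ω' ∈ B) :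
    mass (prodWeight ι μ) (A ∩ B) = mass (prodWeight ι μ) A * mass (prodWeight ι μ) B := by
  rcases isEmpty_or_nonempty (ι → κ) with he | ⟨⟨ω₀⟩⟩
  · have := sum_prodWeight (ι := ι) hμ
    simp at this
  let e := Equiv.piEquivPiSubtypeProd (fun i => I i) (fun _ : ι => κ)
  let a : ({i // I i} → κ) → ℝ := fun x => A.indicator 1 (e.symm (x, (e ω₀).2))
  let b : ({i // ¬ I i} → κ) → ℝ := fun y => B.indicator 1 (e.symm ((e ω₀).1, y))
  have ha : ∀ z, A.indicator (1 : (ι → κ) → ℝ) (e.symm z) = a z.1 := by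
    intro z
    have : e.symm z ∈ A ↔ e.symm (z.1, (e ω₀).2) ∈ A := by
      constructor <;> apply hA <;> intro i hi <;> simp [e, Equiv.piEquivPiSubtypeProd, hi]
    by_cases h : e.symm z ∈ A
    · simp [a, h, this.1 h]
    · simp [a, h, mt this.2 h]
  have hb : ∀ z, B.indicator (1 : (ι → κ) → ℝ) (e.symm z) = b z.2 := by
    intro z
    have : e.symm z ∈ B ↔ e.symm ((e ω₀).1, z.2) ∈ B := by
      constructor <;> apply hB <;> intro i hi <;> simp [e, Equiv.piEquivPiSubtypeProd, hi]
    by_cases h : e.symm z ∈ B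
    · simp [b, h, this.1 h]
    · simp [b, h, mt this.2 h]
  have hm : ∀ z, prodWeight ι μ (e.symm z)
      = prodWeight {i // I i} μ z.1 * prodWeight {i // ¬ I i} μ z.2 := by
    intro z
    unfold prodWeight
    rw [← Fintype.prod_subtype_mul_prod_subtype (fun i => I i)]
    congr 1 <;> refine Fintype.prod_equiv (Equiv.refl _) _ _ fun i => ?_ <;>
      simp [e, Equiv.piEquivPiSubtypeProd, i.2]
  have split : ∀ (S : Set (ι → κ)) (f : ({i // I i} → κ) → ℝ) (g : ({i // ¬ I i} → κ) → ℝ),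
      (∀ z, S.indicator (1 : (ι → κ) → ℝ) (e.symm z) = f z.1 * g z.2) →
      mass (prodWeight ι μ) S = (∑ x, prodWeight {i // I i} μ x * f x) *
        ∑ y, prodWeight {i // ¬ I i} μ y * g y := by
    intro S f g h
    unfold mass
    rw [← e.symm.sum_comp, Fintype.sum_prod_type, Finset.sum_mul_sum]
    refine Finset.sum_congr rfl fun x _ => Finset.sum_congr rfl fun y _ => ?_
    have h1 := h (x, y)
    have h2 : S.indicator (prodWeight ι μ) (e.symm (x, y))
        = prodWeight ι μ (e.symm (x, y)) * S.indicator (1 : (ι → κ) → ℝ) (e.symm (x, y)) := by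
      by_cases hS : e.symm (x, y) ∈ S <;> simp [hS]
    rw [h2, h1, hm]
    ring
  have hAB : ∀ z, (A ∩ B).indicator (1 : (ι → κ) → ℝ) (e.symm z) = a z.1 * b z.2 := by
    intro z
    rw [← ha, ← hb, ← Set.inter_indicator_mul]
    simp only [Pi.one_apply, mul_one]
    rfl
  rw [split _ a b hAB, split A a (fun _ => 1) (fun z => by rw [ha, mul_one]),
    split B (fun _ => 1) b (fun z => by rw [hb, one_mul])]
  simp only [mul_one]
  rw [sum_prodWeight hμ, sum_prodWeight hμ, mul_one, one_mul]

/-- The moment generating function factorises over the vertices, and each factor is bounded by `1 +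
y ≤ exp y`. -/
lemma sum_prodWeight_exp_card_le (hμ : ∀ c, 0 ≤ μ c) (hμ1 : ∑ c, μ c = 1) (S : Finset ι)
    (K : Finset κ) (t : ℝ) :
    ∑ ω : ι → κ, prodWeight ι μ ω * Real.exp (t * (S.filter fun i => ω i ∈ K).card)
      ≤ Real.exp ((∑ c ∈ K, μ c) * S.card * (Real.exp t - 1)) := by
  have h1 : ∀ ω : ι → κ, Real.exp (t * (S.filter fun i => ω i ∈ K).card)
      = ∏ i, (if i ∈ S ∧ ω i ∈ K then Real.exp t else 1) := by
    intro ω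
    rw [mul_comm, Real.exp_nat_mul, Finset.prod_ite]
    rw [Finset.prod_const, Finset.prod_const_one, mul_one]
    congr 2
    ext i
    simp
  simp only [h1]
  rw [sum_prodWeight_mul μ (fun i c => if i ∈ S ∧ c ∈ K then Real.exp t else 1)]
  have h2 : ∀ i, ∑ c, μ c * (if i ∈ S ∧ c ∈ K then Real.exp t else 1)
      = if i ∈ S then 1 + (∑ c ∈ K, μ c) * (Real.exp t - 1) else 1 := by
    intro i
    by_cases hi : i ∈ S
    · have h3 : ∀ c, μ c * (if i ∈ S ∧ c ∈ K then Real.exp t else 1)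
          = μ c + if c ∈ K then μ c * (Real.exp t - 1) else 0 := by
        intro c
        by_cases hc : c ∈ K
        · simp only [hi, hc, and_self, if_true]; ring
        · simp [hc]
      rw [Finset.sum_congr rfl fun c _ => h3 c]
      simp only [Finset.sum_add_distrib, hμ1, Finset.sum_ite_mem, Finset.univ_inter, hi, if_true,
        Finset.sum_mul]
    · simp [hi, hμ1]
  rw [Finset.prod_congr rfl fun i _ => h2 i, Finset.prod_ite]
  simp only [Finset.filter_mem_eq_inter, Finset.univ_inter, Finset.prod_const,
    mul_one, one_pow]
  have h3 : 0 ≤ 1 + (∑ c ∈ K, μ c) * (Real.exp t - 1) := by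
    have h4 : ∑ c ∈ K, μ c ≤ 1 := hμ1 ▸ Finset.sum_le_univ_sum_of_nonneg hμ
    have h5 : 0 ≤ ∑ c ∈ K, μ c := Finset.sum_nonneg fun c _ => hμ c
    nlinarith [Real.exp_pos t]
  calc _ ≤ (Real.exp ((∑ c ∈ K, μ c) * (Real.exp t - 1))) ^ S.card :=
        pow_le_pow_left₀ h3 (by linarith [Real.add_one_le_exp ((∑ c ∈ K, μ c) * (Real.exp t - 1))]) _
    _ = _ := by rw [← Real.exp_nat_mul]; ring_nf

/-- Lower tail of the number of elements of `S` with a colour in `K`. -/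
lemma mass_card_le_le (hμ : ∀ c, 0 ≤ μ c) (hμ1 : ∑ c, μ c = 1) (S : Finset ι) (K : Finset κ)
    (k : ℝ) :
    mass (prodWeight ι μ) {ω | ((S.filter fun i => ω i ∈ K).card : ℝ) ≤ k}
      ≤ Real.exp (k - (∑ c ∈ K, μ c) * S.card / 2) := by
  -- Markov's inequality at the fixed exponent `-1`; since `exp (-1) - 1 ≤ -1/2`, no optimisation is
  -- needed.
  have h1 := mass_le_of_forall_one_le (prodWeight_nonneg (ι := ι) hμ)
    (S := {ω | ((S.filter fun i => ω i ∈ K).card : ℝ) ≤ k})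
    (fun ω => Real.exp (k + (-1) * (S.filter fun i => ω i ∈ K).card)) (fun ω => (Real.exp_pos _).le)
    (fun ω hω => Real.one_le_exp (by simp only [Set.mem_ofPred_eq] at hω; linarith))
  refine h1.trans ?_
  have h2 := sum_prodWeight_exp_card_le hμ hμ1 S K (-1)
  simp only [Real.exp_add k]
  simp only [mul_left_comm _ (Real.exp k), ← Finset.mul_sum]
  rw [sub_eq_add_neg, Real.exp_add]
  refine mul_le_mul_of_nonneg_left (h2.trans (Real.exp_le_exp.2 ?_)) (Real.exp_pos _).le
  have h3 : 0 ≤ (∑ c ∈ K, μ c) * S.card := mul_nonneg (Finset.sum_nonneg fun c _ => hμ c) (by simp)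
  have h4 : Real.exp (-1) ≤ 1 / 2 := by
    rw [Real.exp_neg, inv_eq_one_div]
    exact one_div_le_one_div_of_le (by norm_num) (by linarith [Real.add_one_le_exp (1 : ℝ)])
  nlinarith

/-- Upper tail of the number of elements of `S` with a colour in `K`. -/
lemma mass_le_card_le (hμ : ∀ c, 0 ≤ μ c) (hμ1 : ∑ c, μ c = 1) (S : Finset ι) (K : Finset κ)
    (k : ℝ) :
    mass (prodWeight ι μ) {ω | k ≤ ((S.filter fun i => ω i ∈ K).card : ℝ)}
      ≤ Real.exp (2 * (∑ c ∈ K, μ c) * S.card - k) := by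
  have h1 := mass_le_of_forall_one_le (prodWeight_nonneg (ι := ι) hμ)
    (S := {ω | k ≤ ((S.filter fun i => ω i ∈ K).card : ℝ)})
    (fun ω => Real.exp (-k + 1 * (S.filter fun i => ω i ∈ K).card)) (fun ω => (Real.exp_pos _).le)
    (fun ω hω => Real.one_le_exp (by simp only [Set.mem_ofPred_eq] at hω; linarith))
  refine h1.trans ?_
  have h2 := sum_prodWeight_exp_card_le hμ hμ1 S K 1
  simp only [Real.exp_add (-k)]
  simp only [mul_left_comm _ (Real.exp (-k)), ← Finset.mul_sum]
  rw [sub_eq_neg_add, Real.exp_add]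
  refine mul_le_mul_of_nonneg_left (h2.trans (Real.exp_le_exp.2 ?_)) (Real.exp_pos _).le
  have h3 : 0 ≤ (∑ c ∈ K, μ c) * S.card := mul_nonneg (Finset.sum_nonneg fun c _ => hμ c) (by simp)
  nlinarith [Real.exp_one_lt_d9]

end Product

end StarFactor

namespace StarFactor

/-! ### A weighted Hall theorem. -/

section Hall

variable {V : Type*} [DecidableEq V]

/-- A weighted Hall condition for disjoint `ℓ`-subsets. -/
theorem exists_disjoint_subsets_of_weight (X : Finset V) (N : V → Finset V) (ℓ : ℕ) (w : V → ℝ)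
    (hN : ∀ x ∈ X, (ℓ : ℝ) ≤ w x * (N x).card)
    (hw : ∀ f, ∑ x ∈ X.filter (fun x => f ∈ N x), w x ≤ 1) :
    ∃ L : V → Finset V, (∀ x ∈ X, L x ⊆ N x ∧ (L x).card = ℓ) ∧
      (X : Set V).PairwiseDisjoint L := by
  -- Ordinary Hall applied to `ℓ` copies of each `x`.
  let t : {x // x ∈ X} × Fin ℓ → Finset V := fun z => N z.1
  have hall : ∀ s : Finset ({x // x ∈ X} × Fin ℓ), s.card ≤ (s.biUnion t).card := by
    intro s
    let S : Finset V := s.image fun z => (z.1 : V)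
    have hSX : ∀ x ∈ S, x ∈ X := by
      intro x hx
      obtain ⟨z, -, rfl⟩ := Finset.mem_image.1 hx
      exact z.1.2
    have h1 : s.card ≤ ℓ * S.card := by
      refine Finset.card_le_mul_card_image (f := fun z : {x // x ∈ X} × Fin ℓ => (z.1 : V)) s ℓ
        fun x _ => ?_
      calc _ ≤ (Finset.univ : Finset (Fin ℓ)).card := by
            refine Finset.card_le_card_of_injOn (fun z => z.2) (by simp) ?_
            intro z hz z' hz' h
            simp only [Finset.coe_filter, Set.mem_ofPred_eq] at hz hz'
            exact Prod.ext (Subtype.ext (hz.2.trans hz'.2.symm)) h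
        _ = ℓ := by simp
    have h2 : s.biUnion t = S.biUnion N := by
      ext v
      simp [S, t]
    rw [h2]
    -- Double counting: each `x` spreads `w x` over every element of `N x`, at least `ℓ` in total,
    -- and no element receives more than 1.
    have h3 : (ℓ * S.card : ℝ) ≤ (S.biUnion N).card := by
      calc (ℓ * S.card : ℝ) = ∑ x ∈ S, (ℓ : ℝ) := by simp [mul_comm]
        _ ≤ ∑ x ∈ S, w x * (N x).card := Finset.sum_le_sum fun x hx => hN x (hSX x hx)
        _ = ∑ x ∈ S, ∑ f ∈ S.biUnion N, if f ∈ N x then w x else 0 := by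
            refine Finset.sum_congr rfl fun x hx => ?_
            rw [Finset.sum_ite_mem, Finset.inter_eq_right.2 (Finset.subset_biUnion_of_mem N hx)]
            simp [mul_comm]
        _ = ∑ f ∈ S.biUnion N, ∑ x ∈ S.filter (fun x => f ∈ N x), w x := by
            rw [Finset.sum_comm]
            simp only [Finset.sum_filter]
        _ ≤ ∑ f ∈ S.biUnion N, 1 := by
            refine Finset.sum_le_sum fun f _ => le_trans ?_ (hw f)
            refine Finset.sum_le_sum_of_subset_of_nonneg
              (Finset.filter_subset_filter _ fun x hx => hSX x hx) fun x hx _ => ?_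
            obtain ⟨hxX, hf⟩ := Finset.mem_filter.1 hx
            have hc : (0 : ℝ) < (N x).card := by exact_mod_cast Finset.card_pos.2 ⟨f, hf⟩
            exact nonneg_of_mul_nonneg_left ((Nat.cast_nonneg ℓ).trans (hN x hxX)) hc
        _ = _ := by simp
    exact h1.trans (by exact_mod_cast h3)
  obtain ⟨f, hf, hft⟩ := (Finset.all_card_le_biUnion_card_iff_exists_injective t).1 hall
  refine ⟨fun x => if hx : x ∈ X then Finset.univ.image fun i => f (⟨x, hx⟩, i) else ∅,
    fun x hx => ⟨?_, ?_⟩, ?_⟩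
  · simp only [hx, dif_pos]
    intro v hv
    obtain ⟨i, -, rfl⟩ := Finset.mem_image.1 hv
    exact hft (⟨x, hx⟩, i)
  · simp only [hx, dif_pos]
    rw [Finset.card_image_of_injective _ fun i j h => (Prod.ext_iff.1 (hf h)).2]
    simp
  · intro x hx y hy hxy
    have hx' : x ∈ X := hx
    have hy' : y ∈ X := hy
    simp only [Function.onFun, hx', hy', dif_pos]
    rw [Finset.disjoint_left]
    intro v hv hv'
    obtain ⟨i, -, rfl⟩ := Finset.mem_image.1 hv
    obtain ⟨j, -, h⟩ := Finset.mem_image.1 hv'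
    exact hxy (congrArg Subtype.val (Prod.ext_iff.1 (hf h)).1).symm

end Hall

/-! ### Assembling star factors, and completing a partial one. -/

section Factor

variable {V : Type*} (H : SimpleGraph V)

/-- The subgraph formed by the edges joining `c` to the elements of `S`. -/
def starSubgraph (c : V) (S : Set V) (hS : ∀ v ∈ S, H.Adj c v) : H.Subgraph where
  verts := insert c S
  Adj u v := (u = c ∧ v ∈ S) ∨ (v = c ∧ u ∈ S)
  adj_sub := by
    rintro u v (⟨rfl, h⟩ | ⟨rfl, h⟩)
    · exact hS v h
    · exact (hS u h).symm
  edge_vert := by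
    rintro u v (⟨rfl, h⟩ | ⟨rfl, h⟩)
    · exact Or.inl rfl
    · exact Or.inr h
  symm := ⟨fun u v h => h.symm⟩

lemma isStar_starSubgraph [Finite V] (c : V) (S : Set V) (hS : ∀ v ∈ S, H.Adj c v) :
    IsStar (starSubgraph H c S hS).coe S.ncard := by
  classical
  have hc : c ∉ S := fun h => (hS c h).ne rfl
  let e : S ≃ Fin S.ncard := Finite.equivFinOfCardEq rfl
  let φ : Fin 1 ⊕ Fin S.ncard → (starSubgraph H c S hS).verts :=
    Sum.elim (fun _ => ⟨c, Or.inl rfl⟩) (fun i => ⟨e.symm i, Or.inr (e.symm i).2⟩)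
  have hne : ∀ i, (e.symm i : V) ≠ c := fun i h => hc (h ▸ (e.symm i).2)
  have hφ : Function.Bijective φ := by
    constructor
    · rintro (i | i) (j | j) h
      · rw [Subsingleton.elim i j]
      · exact absurd (Subtype.ext_iff.1 h).symm (hne j)
      · exact absurd (Subtype.ext_iff.1 h) (hne i)
      · have h' : (e.symm i : V) = e.symm j := (congrArg Subtype.val h :)
        rw [e.symm.injective (Subtype.ext h')]
    · rintro ⟨v, rfl | hv⟩
      · exact ⟨Sum.inl 0, rfl⟩
      · exact ⟨Sum.inr (e ⟨v, hv⟩), by simp [φ]⟩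
  have hadj : ∀ x y, (starSubgraph H c S hS).coe.Adj (φ x) (φ y) ↔
      (completeBipartiteGraph (Fin 1) (Fin S.ncard)).Adj x y := by
    rintro (i | i) (j | j) <;> simp [starSubgraph, φ, hne, hc]
  exact ⟨SimpleGraph.Iso.symm ⟨Equiv.ofBijective φ hφ, fun {x y} => hadj x y⟩⟩

theorem hasStarFactor_of_forall_exists_center [Finite V] (G : SimpleGraph V) (K : Set V) (g : V → V)
    (ℓ : ℕ) (hg : ∀ v ∉ K, g v ∈ K ∧ G.Adj (g v) v) (hℓ : ∀ c ∈ K, ℓ ≤ {v | v ∉ K ∧ g v = c}.ncard) :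
    HasStarFactor G ℓ := by
  let S : V → Set V := fun c => {v | v ∉ K ∧ g v = c}
  have hS : ∀ c, ∀ v ∈ S c, G.Adj c v := fun c v hv => hv.2 ▸ (hg v hv.1).2
  refine ⟨{T | ∃ c ∈ K, T = starSubgraph G c (S c) (hS c)}, ⟨?_, ?_⟩, ?_⟩
  · rintro _ ⟨c, hc, rfl⟩
    exact ⟨_, hℓ c hc, isStar_starSubgraph G c _ (hS c)⟩
  · rintro _ ⟨c, hc, rfl⟩ _ ⟨c', hc', rfl⟩ hne
    have hcc : c ≠ c' := by rintro rfl; exact hne rfl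
    rw [Set.disjoint_left]
    rintro v (rfl | hv) (rfl | hv')
    · exact hcc rfl
    · exact hv'.1 hc
    · exact hv.1 hc'
    · exact hcc (hv.2.symm.trans hv'.2)
  · intro v
    by_cases hv : v ∈ K
    · exact ⟨_, ⟨v, hv, rfl⟩, Or.inl rfl⟩
    · exact ⟨_, ⟨g v, (hg v hv).1, rfl⟩, Or.inr ⟨hv, rfl⟩⟩

/-- Stars may exceed size `ℓ`, so once every centre has its `ℓ` leaves, each other vertex can join
any adjacent centre. -/
theorem hasStarFactor_of_disjoint_leaves [Fintype V] [DecidableEq V] (G : SimpleGraph V)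
    (K : Finset V) (L : V → Finset V) (ℓ : ℕ) (hadj : ∀ c ∈ K, ∀ v ∈ L c, G.Adj c v ∧ v ∉ K)
    (hcard : ∀ c ∈ K, ℓ ≤ (L c).card) (hdisj : (K : Set V).PairwiseDisjoint L)
    (hcover : ∀ v ∉ K, (∀ c ∈ K, v ∉ L c) → ∃ c ∈ K, G.Adj c v) : HasStarFactor G ℓ := by
  have h : ∀ v, ∃ c, v ∉ K → c ∈ K ∧ G.Adj c v ∧ ∀ c' ∈ K, v ∈ L c' → c' = c := by
    intro v
    by_cases hv : v ∈ K
    · exact ⟨v, fun h => absurd hv h⟩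
    by_cases hL : ∃ c ∈ K, v ∈ L c
    · obtain ⟨c, hc, hvc⟩ := hL
      refine ⟨c, fun _ => ⟨hc, (hadj c hc v hvc).1, fun c' hc' hvc' => ?_⟩⟩
      by_contra hne
      exact Finset.disjoint_left.1 (hdisj hc' hc hne) hvc' hvc
    · push Not at hL
      obtain ⟨c, hc, hcv⟩ := hcover v hv hL
      exact ⟨c, fun _ => ⟨hc, hcv, fun c' hc' hv' => absurd hv' (hL c' hc')⟩⟩
  choose g hg using h
  refine hasStarFactor_of_forall_exists_center G K g ℓ
    (fun v hv => ⟨(hg v hv).1, (hg v hv).2.1⟩) fun c hc => ?_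
  refine (hcard c hc).trans ?_
  rw [← Set.ncard_coe_finset]
  refine Set.ncard_le_ncard (fun v hv => ?_) (Set.toFinite _)
  have hvK := (hadj c hc v hv).2
  exact ⟨hvK, ((hg v hvK).2.2 c hc hv).symm⟩

/-- Stars for the centres `X` are given, with leaves in `F`; all the other vertices of `P` are
adjacent to `X`, and the other vertices are adjacent to `X` or have many neighbours in
`P \ (F ∪ X)`. -/
theorem hasStarFactor_of_partial [Fintype V] [DecidableEq V] (G : SimpleGraph V)
    [DecidableRel G.Adj] (X F P : Finset V) (ℓ : ℕ) (m : ℝ) (hm : 0 < m) (hℓ : (ℓ : ℝ) * ℓ ≤ m)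
    (hXF : Disjoint X F) (L : V → Finset V) (hL : ∀ x ∈ X, L x ⊆ G.neighborFinset x ∩ F)
    (hLc : ∀ x ∈ X, (L x).card = ℓ) (hLd : (X : Set V).PairwiseDisjoint L)
    (hP : ∀ v ∈ P, v ∉ X → ∃ x ∈ X, G.Adj x v)
    (hQ : ∀ v ∉ P, v ∉ X → (∃ x ∈ X, G.Adj x v) ∨
      m ≤ ((G.neighborFinset v ∩ (P \ (F ∪ X))).card : ℝ)) : HasStarFactor G ℓ := by
  set Z := P \ (F ∪ X) with hZ
  set U := X.biUnion L with hU
  set Q := Finset.univ \ (P ∪ X ∪ U) with hQdef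
  have hUF : ∀ v ∈ U, v ∈ F := by
    intro v hv
    obtain ⟨x, hx, hvx⟩ := Finset.mem_biUnion.1 hv
    exact (Finset.mem_inter.1 (hL x hx hvx)).2
  let good : Finset V → (V → Finset V) → Prop := fun C M =>
    (∀ c ∈ C, M c ⊆ G.neighborFinset c ∩ Q ∧ (M c).card = ℓ) ∧ (C : Set V).PairwiseDisjoint M
  classical
  obtain ⟨C, hC, hmax⟩ : ∃ C ∈ Z.powerset.filter (fun C => ∃ M, good C M),
      ∀ C' ∈ Z.powerset.filter (fun C => ∃ M, good C M), C'.card ≤ C.card :=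
    Finset.exists_max_image _ _ ⟨∅, by simp [good]⟩
  obtain ⟨hCZ, M, hM, hMd⟩ := Finset.mem_filter.1 hC
  rw [Finset.mem_powerset] at hCZ
  set W := (Q \ C.biUnion M).filter (fun w => ∀ c ∈ C ∪ X, ¬ G.Adj c w) with hW
  -- Otherwise `a`, with `ℓ` of its neighbours in `W` as leaves, would extend the maximal family.
  have hsmall : ∀ a ∈ Z, a ∉ C → ((G.neighborFinset a) ∩ W).card ≤ ℓ := by
    intro a ha haC
    by_contra! hlt
    obtain ⟨T, hT, hTc⟩ := Finset.exists_subset_card_eq hlt.le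
    have hup : ∀ c ∈ C, Function.update M a T c = M c := fun c hc =>
      Function.update_of_ne (ne_of_mem_of_not_mem hc haC) _ _
    have hTW : ∀ v ∈ T, v ∈ Q ∧ ∀ c ∈ C, v ∉ M c := by
      intro v hv
      have h1 := (Finset.mem_inter.1 (hT hv)).2
      have h2 := Finset.mem_sdiff.1 (Finset.mem_filter.1 h1).1
      exact ⟨h2.1, fun c hc hvc => h2.2 (Finset.mem_biUnion.2 ⟨c, hc, hvc⟩)⟩
    have := hmax (insert a C) (by
      refine Finset.mem_filter.2 ⟨Finset.mem_powerset.2 (Finset.insert_subset ha hCZ),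
        Function.update M a T, fun c hc => ?_, ?_⟩
      · rcases Finset.mem_insert.1 hc with rfl | hc
        · rw [Function.update_self]
          refine ⟨fun v hv => Finset.mem_inter.2 ⟨(Finset.mem_inter.1 (hT hv)).1, (hTW v hv).1⟩, hTc⟩
        · rw [hup c hc]
          exact hM c hc
      · rw [Finset.coe_insert]
        refine Set.PairwiseDisjoint.insert ?_ ?_
        · intro c hc c' hc' hne
          simp only [Function.onFun, hup c hc, hup c' hc']
          exact hMd hc hc' hne
        · intro c hc _
          rw [Function.update_self, hup c hc, Finset.disjoint_left]
          exact fun v hv => (hTW v hv).2 c hc)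
    rw [Finset.card_insert_of_notMem haC] at this
    omega
  have hWmem : ∀ w ∈ W, w ∉ P ∧ w ∉ X ∧ w ∉ U ∧ (∀ c ∈ C, w ∉ M c) ∧
      ∀ c ∈ C ∪ X, ¬ G.Adj c w := by
    intro w hw
    obtain ⟨h1, h2⟩ := Finset.mem_filter.1 hw
    simp only [hQdef, Finset.mem_sdiff, Finset.mem_univ, true_and, Finset.mem_union,
      Finset.mem_biUnion, not_or, not_exists, not_and] at h1
    exact ⟨h1.1.1.1, h1.1.1.2, h1.1.2, h1.2, h2⟩
  -- Constant weight `ℓ / m`: each `w ∈ W` has at least `m` neighbours in `Z`, and each vertex of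
  -- `Z` is used by at most `ℓ` of them, a load of at most `ℓ ^ 2 / m ≤ 1`. Vertices of `C` carry no
  -- load, being nonadjacent to `W`.
  obtain ⟨R, hR, hRd⟩ := exists_disjoint_subsets_of_weight W
    (fun w => G.neighborFinset w ∩ Z) ℓ (fun _ => ℓ / m)
    (by
      intro w hw
      obtain ⟨h1, h2, -, -, h5⟩ := hWmem w hw
      have h6 := (hQ w h1 h2).resolve_left (by
        rintro ⟨x, hx, hxw⟩
        exact h5 x (Finset.mem_union_right _ hx) hxw)
      calc (ℓ : ℝ) = ℓ / m * m := by field_simp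
        _ ≤ _ := mul_le_mul_of_nonneg_left h6 (by positivity))
    (by
      intro f
      rw [Finset.sum_const, nsmul_eq_mul]
      have h1 : (W.filter fun w => f ∈ G.neighborFinset w ∩ Z).card ≤ ℓ := by
        by_cases hf : f ∈ Z ∧ f ∉ C
        · refine le_trans (Finset.card_le_card fun w hw => ?_) (hsmall f hf.1 hf.2)
          simp only [Finset.mem_filter, Finset.mem_inter, SimpleGraph.mem_neighborFinset] at hw ⊢
          exact ⟨hw.2.1.symm, hw.1⟩
        · rw [Finset.filter_eq_empty_iff.2]
          · simp
          · intro w hw hfw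
            simp only [Finset.mem_inter, SimpleGraph.mem_neighborFinset] at hfw
            have hfC : f ∈ C := by by_contra h; exact hf ⟨hfw.2, h⟩
            exact (hWmem w hw).2.2.2.2 f (Finset.mem_union_left _ hfC) hfw.1.symm
      calc _ ≤ (ℓ : ℝ) * (ℓ / m) := by gcongr
        _ = ℓ * ℓ / m := by ring
        _ ≤ 1 := (div_le_one hm).2 hℓ)
  have hZX : ∀ v ∈ Z, v ∈ P ∧ v ∉ F ∧ v ∉ X := by
    intro v hv
    simp only [hZ, Finset.mem_sdiff, Finset.mem_union, not_or] at hv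
    exact hv
  have hCX : ∀ v ∈ C, v ∉ X := fun v hv => (hZX v (hCZ hv)).2.2
  have hRmem : ∀ w ∈ W, ∀ v ∈ R w, G.Adj w v ∧ v ∈ Z ∧ v ∉ C := by
    intro w hw v hv
    have h := Finset.mem_inter.1 ((hR w hw).1 hv)
    have h1 := (G.mem_neighborFinset w v).1 h.1
    exact ⟨h1, h.2, fun hC => (hWmem w hw).2.2.2.2 v (Finset.mem_union_left _ hC) h1.symm⟩
  have hMmem : ∀ c ∈ C, ∀ v ∈ M c, G.Adj c v ∧ v ∉ P ∧ v ∉ X ∧ v ∉ U := by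
    intro c hc v hv
    have h := Finset.mem_inter.1 ((hM c hc).1 hv)
    have h2 := h.2
    simp only [hQdef, Finset.mem_sdiff, Finset.mem_univ, true_and, Finset.mem_union, not_or] at h2
    exact ⟨(G.mem_neighborFinset c v).1 h.1, h2.1.1, h2.1.2, h2.2⟩
  have hLmem : ∀ x ∈ X, ∀ v ∈ L x, G.Adj x v ∧ v ∈ F ∧ v ∈ U := by
    intro x hx v hv
    have h := Finset.mem_inter.1 (hL x hx hv)
    exact ⟨(G.mem_neighborFinset x v).1 h.1, h.2, Finset.mem_biUnion.2 ⟨x, hx, hv⟩⟩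
  let Y : V → Finset V := fun v => if v ∈ X then L v else if v ∈ C then M v else R v
  have hYX : ∀ v ∈ X, Y v = L v := fun v hv => if_pos hv
  have hYC : ∀ v ∈ C, Y v = M v := fun v hv => by simp [Y, hCX v hv, hv]
  have hYW : ∀ v ∈ W, Y v = R v := fun v hv => by
    have h1 : v ∉ C := fun h => (hWmem v hv).1 (hZX v (hCZ h)).1
    simp [Y, (hWmem v hv).2.1, h1]
  have hK : ∀ v, v ∈ X ∪ C ∪ W → v ∈ X ∨ v ∈ C ∨ v ∈ W := by
    intro v hv
    simpa [or_assoc] using hv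
  have hXM : ∀ x ∈ X, ∀ c ∈ C, Disjoint (Y x) (Y c) := by
    intro x hx c hc
    rw [hYX x hx, hYC c hc, Finset.disjoint_left]
    exact fun v hv hv' => (hMmem c hc v hv').2.2.2 (hLmem x hx v hv).2.2
  have hXR : ∀ x ∈ X, ∀ w ∈ W, Disjoint (Y x) (Y w) := by
    intro x hx w hw
    rw [hYX x hx, hYW w hw, Finset.disjoint_left]
    exact fun v hv hv' => (hZX v (hRmem w hw v hv').2.1).2.1 (hLmem x hx v hv).2.1
  have hMR : ∀ c ∈ C, ∀ w ∈ W, Disjoint (Y c) (Y w) := by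
    intro c hc w hw
    rw [hYC c hc, hYW w hw, Finset.disjoint_left]
    exact fun v hv hv' => (hMmem c hc v hv).2.1 (hZX v (hRmem w hw v hv').2.1).1
  refine hasStarFactor_of_disjoint_leaves G (X ∪ C ∪ W) Y ℓ ?_ ?_ ?_ ?_
  · intro c hc v hv
    rcases hK c hc with h | h | h
    · rw [hYX c h] at hv
      have h1 := hLmem c h v hv
      refine ⟨h1.1, fun hvK => ?_⟩
      rcases hK v hvK with h2 | h2 | h2
      · exact Finset.disjoint_left.1 hXF h2 h1.2.1
      · exact (hZX v (hCZ h2)).2.1 h1.2.1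
      · exact (hWmem v h2).2.2.1 h1.2.2
    · rw [hYC c h] at hv
      have h1 := hMmem c h v hv
      refine ⟨h1.1, fun hvK => ?_⟩
      rcases hK v hvK with h2 | h2 | h2
      · exact h1.2.2.1 h2
      · exact h1.2.1 (hZX v (hCZ h2)).1
      · exact (hWmem v h2).2.2.2.1 c h hv
    · rw [hYW c h] at hv
      have h1 := hRmem c h v hv
      refine ⟨h1.1, fun hvK => ?_⟩
      rcases hK v hvK with h2 | h2 | h2
      · exact (hZX v h1.2.1).2.2 h2
      · exact h1.2.2 h2
      · exact (hWmem v h2).1 (hZX v h1.2.1).1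
  · intro c hc
    rcases hK c hc with h | h | h
    · rw [hYX c h, hLc c h]
    · rw [hYC c h, (hM c h).2]
    · rw [hYW c h, (hR c h).2]
  · intro c hc c' hc' hne
    simp only [Function.onFun]
    rcases hK c hc with h | h | h <;> rcases hK c' hc' with h' | h' | h'
    · rw [hYX c h, hYX c' h']; exact hLd h h' hne
    · exact hXM c h c' h'
    · exact hXR c h c' h'
    · exact (hXM c' h' c h).symm
    · rw [hYC c h, hYC c' h']; exact hMd h h' hne
    · exact hMR c h c' h'
    · exact (hXR c' h' c h).symm
    · exact (hMR c' h' c h).symm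
    · rw [hYW c h, hYW c' h']; exact hRd h h' hne
  · intro v hv hvL
    simp only [Finset.mem_union, not_or] at hv
    by_cases hvP : v ∈ P
    · obtain ⟨x, hx, hxv⟩ := hP v hvP hv.1.1
      exact ⟨x, by simp [hx], hxv⟩
    · have hvU : v ∉ U := by
        intro h
        obtain ⟨x, hx, hvx⟩ := Finset.mem_biUnion.1 h
        exact hvL x (by simp [hx]) (by rwa [hYX x hx])
      have hvM : v ∉ C.biUnion M := by
        intro h
        obtain ⟨x, hx, hvx⟩ := Finset.mem_biUnion.1 h
        exact hvL x (by simp [hx]) (by rwa [hYC x hx])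
      -- A vertex adjacent to no centre would itself satisfy the definition of `W`, hence be a
      -- centre.
      by_contra! hcon
      refine hv.2 (Finset.mem_filter.2 ⟨Finset.mem_sdiff.2 ⟨?_, hvM⟩, fun c hc => ?_⟩)
      · simp [hQdef, hvP, hv.1.1, hvU]
      · refine hcon c ?_
        simp only [Finset.mem_union] at hc ⊢
        tauto

end Factor

/-- Stars need not be induced, which is what permits passing to an edge-minimal subgraph. -/
lemma HasStarFactor.mono {V : Type*} {H G : SimpleGraph V} (h : H ≤ G) {ℓ : ℕ}
    (hH : HasStarFactor H ℓ) : HasStarFactor G ℓ := by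
  obtain ⟨P, ⟨hstar, hdisj⟩, hcover⟩ := hH
  let φ : H.Subgraph → G.Subgraph := fun S =>
    { verts := S.verts, Adj := S.Adj, adj_sub := fun hS => h (S.adj_sub hS),
      edge_vert := S.edge_vert, symm := S.symm }
  refine ⟨φ '' P, ⟨?_, ?_⟩, fun v => ?_⟩
  · rintro _ ⟨S, hS, rfl⟩
    exact hstar S hS
  · rintro _ ⟨S, hS, rfl⟩ _ ⟨S', hS', rfl⟩ hne
    exact hdisj hS hS' (fun e => hne (e ▸ rfl))
  · obtain ⟨S, hS, hv⟩ := hcover v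
    exact ⟨φ S, ⟨S, hS, rfl⟩, hv⟩

end StarFactor

namespace StarFactor

/-! ### Balanced colourings from the local lemma. -/

section Colouring

variable {V κ : Type*} [Fintype V] [DecidableEq V] [Fintype κ] [DecidableEq κ] {μ : κ → ℝ}

/-- The local lemma for random colourings, when the event at `v` depends on the colours of `Ns v`. -/
theorem exists_colouring_of_local (hμ : ∀ c, 0 ≤ μ c) (hμ1 : ∑ c, μ c = 1) (Ns : V → Finset V)
    (Ev : V → Set (V → κ)) (k : ℕ) (hk : 1 ≤ k) (hcard : ∀ v, (Ns v).card ≤ k)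
    (hcard' : ∀ u, (Finset.univ.filter fun v => u ∈ Ns v).card ≤ k) {q : ℝ} (hq : 0 ≤ q)
    (hkq : 4 * (k ^ 2 : ℝ) * q ≤ 1) (hmass : ∀ v, mass (prodWeight V μ) (Ev v) ≤ q)
    (hdep : ∀ v ω ω', (∀ u ∈ Ns v, ω u = ω' u) → ω ∈ Ev v → ω' ∈ Ev v) :
    ∃ ω, ∀ v, ω ∉ Ev v := by
  have hw := prodWeight_nonneg (ι := V) hμ
  refine exists_forall_notMem_of_local (w := prodWeight V μ) hw
    (by rw [sum_prodWeight hμ1]; norm_num) Ev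
    (fun v => Finset.univ.filter fun u => ¬ Disjoint (Ns u) (Ns v)) (Δ := (k : ℝ) ^ 2) (q := q)
    (one_le_pow₀ (by exact_mod_cast hk)) hq (fun v => ?_) hkq (fun v T hT => ?_)
  · have h1 : (Finset.univ.filter fun u => ¬ Disjoint (Ns u) (Ns v)) ⊆
        (Ns v).biUnion fun t => Finset.univ.filter fun u => t ∈ Ns u := by
      intro u hu
      obtain ⟨t, ht, ht'⟩ := Finset.not_disjoint_iff.1 (Finset.mem_filter.1 hu).2
      exact Finset.mem_biUnion.2 ⟨t, ht', by simp [ht]⟩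
    have h2 := (Finset.card_le_card h1).trans
      (Finset.card_biUnion_le_card_mul _ _ k fun t _ => hcard' t)
    have h3 : (Ns v).card * k ≤ k ^ 2 := by
      rw [sq]; exact Nat.mul_le_mul_right k (hcard v)
    exact_mod_cast h2.trans h3
  · rw [mass_inter_of_disjoint_support hμ1 (fun u => u ∈ Ns v) (hdep v)]
    · exact mul_le_mul_of_nonneg_right (hmass v) (mass_nonneg hw _)
    · intro ω ω' h hω j hj hω'
      refine hω j hj (hdep j ω' ω (fun u hu => (h u fun hv => ?_).symm) hω')
      refine Finset.disjoint_left.1 hT hj (Finset.mem_filter.2 ⟨Finset.mem_univ j, ?_⟩)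
      exact Finset.not_disjoint_iff.2 ⟨u, hu, hv⟩

lemma filter_mem_congr {V κ : Type*} [DecidableEq κ] {S T : Finset V} (hST : S ⊆ T) (K : Finset κ) {ω ω' : V → κ}
    (h : ∀ u ∈ T, ω u = ω' u) : S.filter (fun i => ω i ∈ K) = S.filter (fun i => ω' i ∈ K) :=
  Finset.filter_congr fun u hu => by rw [h u (hST hu)]

lemma mass_setOf_and_le {Ω : Type*} [Fintype Ω] {w : Ω → ℝ} {c : Prop} {S : Set Ω} {q : ℝ}
    (hq : 0 ≤ q) (h : c → mass w S ≤ q) : mass w {ω | c ∧ ω ∈ S} ≤ q := by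
  by_cases hc : c
  · simpa [hc] using h hc
  · simpa [hc, mass_empty] using hq

/-- A colouring in which the colours `1` and `2` have about the expected frequencies `p` and `ε` in
the given local sets. -/
theorem exists_balanced_colouring (Ns T₁ T₂ : V → Finset V) (hT₁ : ∀ v, T₁ v ⊆ Ns v)
    (hT₂ : ∀ v, T₂ v ⊆ Ns v) (d : ℕ) (ε p : ℝ) (hd : 16 ≤ d) (hp : 0 < p) (hpε : p ≤ ε)
    (hε : 7 * ε < 1) (hcard : ∀ v, (Ns v).card ≤ d ^ 2)
    (hcard' : ∀ u, (Finset.univ.filter fun v => u ∈ Ns v).card ≤ d ^ 2)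
    (h₁ : Real.exp (-(p * ε * d / 2)) ≤ 1 / d ^ 5) (h₂ : Real.exp (-(p * d)) ≤ 1 / d ^ 5)
    (h₃ : Real.exp (-(ε * d / 8)) ≤ 1 / d ^ 5) :
    ∃ ω : V → Fin 3, ∀ v,
      (ε * d ≤ (T₁ v).card → ∃ u ∈ T₁ v, ω u = 1) ∧
      ((Ns v).card ≤ d → (((Ns v).filter fun u => ω u = 1).card : ℝ) < 3 * p * d) ∧
      ((d : ℝ) / 2 ≤ (T₂ v).card →
        ε / 4 * (T₂ v).card < ((T₂ v).filter fun u => ω u = 2).card) ∧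
      (((Ns v).filter fun u => ω u ≠ 0).card : ℝ) < 6 * ε * (max d (Ns v).card : ℕ) := by
  let μ : Fin 3 → ℝ := ![1 - p - ε, p, ε]
  have hμ : ∀ c, 0 ≤ μ c := by
    intro c
    fin_cases c <;> simp [μ] <;> linarith
  have hμ1 : ∑ c, μ c = 1 := by simp [μ, Fin.sum_univ_three]; ring
  have hK1 : ∑ c ∈ ({1} : Finset (Fin 3)), μ c = p := by simp [μ]
  have hK2 : ∑ c ∈ ({2} : Finset (Fin 3)), μ c = ε := by simp [μ]
  have hK3 : ∑ c ∈ ({1, 2} : Finset (Fin 3)), μ c = p + ε := by simp [μ]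
  have hw := prodWeight_nonneg (ι := V) hμ
  have hd0 : (16 : ℝ) ≤ d := by exact_mod_cast hd
  set δ : ℝ := 1 / d ^ 5 with hδ
  have hδ0 : 0 ≤ δ := by positivity
  let E₁ : V → Set (V → Fin 3) := fun v => {ω | ε * d ≤ (T₁ v).card ∧
    ω ∈ {ω : V → Fin 3 | (((T₁ v).filter fun i => ω i ∈ ({1} : Finset (Fin 3))).card : ℝ) ≤ 0}}
  let E₂ : V → Set (V → Fin 3) := fun v => {ω | (Ns v).card ≤ d ∧
    ω ∈ {ω : V → Fin 3 | 3 * p * d ≤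
      (((Ns v).filter fun i => ω i ∈ ({1} : Finset (Fin 3))).card : ℝ)}}
  let E₃ : V → Set (V → Fin 3) := fun v => {ω | (d : ℝ) / 2 ≤ (T₂ v).card ∧
    ω ∈ {ω : V → Fin 3 | (((T₂ v).filter fun i => ω i ∈ ({2} : Finset (Fin 3))).card : ℝ)
      ≤ ε / 4 * (T₂ v).card}}
  let E₄ : V → Set (V → Fin 3) := fun v => {ω | 6 * ε * (max d (Ns v).card : ℕ) ≤
      (((Ns v).filter fun i => ω i ∈ ({1, 2} : Finset (Fin 3))).card : ℝ)}
  obtain ⟨ω, hω⟩ := exists_colouring_of_local hμ hμ1 Ns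
    (fun v => (E₁ v ∪ E₂ v) ∪ (E₃ v ∪ E₄ v)) (d ^ 2) (Nat.one_le_pow _ _ (by omega)) hcard hcard'
    (q := δ + δ + (δ + δ)) (by positivity)
    (by
      rw [hδ]
      push_cast
      -- Dependency degree `d ^ 4` against four bad events of mass `1 / d ^ 5` each: this is where
      -- `16 ≤ d` enters.
      have : 4 * ((d : ℝ) ^ 2) ^ 2 * (1 / d ^ 5 + 1 / d ^ 5 + (1 / d ^ 5 + 1 / d ^ 5)) = 16 / d := by
        field_simp
        norm_num
      rw [this, div_le_one (by linarith)]
      exact hd0)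
    (by
      intro v
      refine (mass_union_le hw _ _).trans (add_le_add ((mass_union_le hw _ _).trans
        (add_le_add ?_ ?_)) ((mass_union_le hw _ _).trans (add_le_add ?_ ?_)))
      · refine mass_setOf_and_le hδ0 fun h => (mass_card_le_le hμ hμ1 _ _ _).trans
          ((Real.exp_le_exp.2 ?_).trans h₁)
        rw [hK1]
        nlinarith
      · refine mass_setOf_and_le hδ0 fun h => (mass_le_card_le hμ hμ1 _ _ _).trans
          ((Real.exp_le_exp.2 ?_).trans h₂)
        rw [hK1]
        have h' : ((Ns v).card : ℝ) ≤ d := by exact_mod_cast h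
        nlinarith
      · refine mass_setOf_and_le hδ0 fun h => (mass_card_le_le hμ hμ1 _ _ _).trans
          ((Real.exp_le_exp.2 ?_).trans h₃)
        rw [hK2]
        nlinarith
      · refine (mass_le_card_le hμ hμ1 _ _ _).trans ((Real.exp_le_exp.2 ?_).trans h₃)
        rw [hK3]
        have h1 : ((Ns v).card : ℝ) ≤ (max d (Ns v).card : ℕ) := by exact_mod_cast le_max_right _ _
        have h2 : (d : ℝ) ≤ (max d (Ns v).card : ℕ) := by exact_mod_cast le_max_left _ _
        have h3 : 2 * (p + ε) * (Ns v).card ≤ 4 * ε * (max d (Ns v).card : ℕ) := by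
          refine mul_le_mul ?_ h1 (Nat.cast_nonneg _) ?_ <;> linarith
        have h4 : ε * d ≤ ε * (max d (Ns v).card : ℕ) := by gcongr; linarith
        have h5 : 0 ≤ ε * d := mul_nonneg (by linarith) (Nat.cast_nonneg _)
        linarith)
    (by
      intro v ω ω' h hω
      simp only [E₁, E₂, E₃, E₄, Set.mem_union, Set.mem_ofPred_eq] at hω ⊢
      rwa [filter_mem_congr (hT₁ v) _ h, filter_mem_congr subset_rfl {1} h,
        filter_mem_congr (hT₂ v) _ h, filter_mem_congr subset_rfl {1, 2} h] at hω)
  refine ⟨ω, fun v => ?_⟩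
  have h := hω v
  simp only [E₁, E₂, E₃, E₄, Set.mem_union, Set.mem_ofPred_eq, not_or, not_and, not_le,
    Finset.mem_singleton, Finset.mem_insert] at h
  obtain ⟨⟨e1, e2⟩, e3, e4⟩ := h
  refine ⟨fun hv => ?_, e2, e3, ?_⟩
  · have h5 := e1 hv
    rw [Nat.cast_pos, Finset.card_pos] at h5
    obtain ⟨u, hu⟩ := h5
    exact ⟨u, (Finset.mem_filter.1 hu).1, (Finset.mem_filter.1 hu).2⟩
  · have h6 : ∀ c : Fin 3, c ≠ 0 ↔ c = 1 ∨ c = 2 := by decide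
    simpa only [h6] using e4

end Colouring

end StarFactor

namespace StarFactor

/-! ### Edge-minimal graphs: the main construction. -/

section Minimal

variable {V : Type*} [Fintype V] [DecidableEq V]

/-- In a minimal subgraph, an edge with both ends of degree above `d` could be deleted. -/
theorem exists_edge_minimal (G : SimpleGraph V) [DecidableRel G.Adj] (d : ℕ)
    (hG : ∀ v, d ≤ G.degree v) :
    ∃ (H : SimpleGraph V) (_ : DecidableRel H.Adj), H ≤ G ∧ (∀ v, d ≤ H.degree v) ∧
      ∀ u v, H.Adj u v → H.degree u = d ∨ H.degree v = d := by
  classical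
  let S : Set (SimpleGraph V) := {H | H ≤ G ∧ ∀ v, d ≤ H.degree v}
  have hS : S.Nonempty := ⟨G, le_rfl, fun v => by convert hG v⟩
  obtain ⟨H, hH⟩ := (Set.toFinite S).exists_minimal hS
  refine ⟨H, Classical.decRel _, hH.1.1, fun v => by convert hH.1.2 v, fun u v huv => ?_⟩
  by_contra! hcon
  have hu : d < H.degree u := lt_of_le_of_ne (hH.1.2 u) (fun h => hcon.1 (by rw [h]))
  have hv : d < H.degree v := lt_of_le_of_ne (hH.1.2 v) (fun h => hcon.2 (by rw [h]))
  have hmem : H.deleteEdges {s(u, v)} ∈ S := by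
    refine ⟨(H.deleteEdges_le _).trans hH.1.1, fun w => ?_⟩
    have hsub : ∀ x y, w = x → (∀ z, s(w, z) = s(u, v) → z = y) → d < H.degree w →
        d ≤ (H.deleteEdges {s(u, v)}).degree w := by
      intro x y _ hz hw
      have h1 : (H.neighborFinset w).erase y ⊆ (H.deleteEdges {s(u, v)}).neighborFinset w := by
        intro z hzm
        rw [Finset.mem_erase, SimpleGraph.mem_neighborFinset] at hzm
        rw [SimpleGraph.mem_neighborFinset, SimpleGraph.deleteEdges_adj]
        exact ⟨hzm.2, fun h => hzm.1 (hz z h)⟩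
      have h2 := (Finset.pred_card_le_card_erase).trans (Finset.card_le_card h1)
      rw [SimpleGraph.card_neighborFinset_eq_degree, SimpleGraph.card_neighborFinset_eq_degree] at h2
      omega
    by_cases hwu : w = u
    · subst hwu
      convert hsub w v rfl (fun z h => Sym2.congr_right.1 h) hu
    by_cases hwv : w = v
    · subst hwv
      convert hsub w u rfl (fun z h => Sym2.congr_right.1 (h.trans Sym2.eq_swap)) hv
    · refine (hH.1.2 w).trans ?_
      rw [← SimpleGraph.card_neighborFinset_eq_degree, ← SimpleGraph.card_neighborFinset_eq_degree]
      refine Finset.card_le_card fun z hz => ?_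
      rw [SimpleGraph.mem_neighborFinset] at hz ⊢
      rw [SimpleGraph.deleteEdges_adj]
      refine ⟨hz, fun h => ?_⟩
      rcases Sym2.eq_iff.1 h with h | h
      · exact hwu h.1
      · exact hwv h.1
  have hle := hH.2 hmem (H.deleteEdges_le _)
  have := hle huv
  rw [SimpleGraph.deleteEdges_adj] at this
  exact this.2 rfl

theorem hasStarFactor_of_edge_minimal (H : SimpleGraph V) [DecidableRel H.Adj] (d ℓ : ℕ) (ε p : ℝ)
    (hd : 16 ≤ d) (hdeg : ∀ v, d ≤ H.degree v)
    (hmin : ∀ u v, H.Adj u v → H.degree u = d ∨ H.degree v = d)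
    (hp : 0 < p) (hpε : p ≤ ε) (hε : 7 * ε < 1)
    (h₁ : Real.exp (-(p * ε * d / 2)) ≤ 1 / d ^ 5) (h₂ : Real.exp (-(p * d)) ≤ 1 / d ^ 5)
    (h₃ : Real.exp (-(ε * d / 8)) ≤ 1 / d ^ 5)
    (hload : (24 * p * d + 4) * ℓ ≤ ε * d) (hℓ : (ℓ : ℝ) * ℓ ≤ (1 - 7 * ε) * d) :
    HasStarFactor H ℓ := by
  have hd0 : (16 : ℝ) ≤ d := by exact_mod_cast hd
  have hε0 : 0 < ε := hp.trans_le hpε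
  have hdd : d < d ^ 2 := by nlinarith
  have hNcard : ∀ v, (H.neighborFinset v).card = H.degree v :=
    fun v => H.card_neighborFinset_eq_degree v
  set A := Finset.univ.filter fun v => H.degree v = d with hA
  set N := A.filter fun v => 2 * (H.neighborFinset v ∩ A).card < d with hN
  set B := A.filter fun v => (1 - ε) * d < (H.neighborFinset v ∩ N).card with hB
  set Big := Finset.univ.filter fun v => d ^ 2 < H.degree v with hBig
  have memA : ∀ v, v ∈ A ↔ H.degree v = d := fun v => by simp [hA]
  have memBig : ∀ v, v ∈ Big ↔ d ^ 2 < H.degree v := fun v => by simp [hBig]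
  have hNA : ∀ v ∈ N, v ∈ A := fun v hv => (Finset.mem_filter.1 hv).1
  have hBA : ∀ v ∈ B, v ∈ A := fun v hv => (Finset.mem_filter.1 hv).1
  have hABig : ∀ v ∈ A, v ∉ Big := fun v hv h => by
    rw [memA] at hv; rw [memBig] at h; omega
  have hadjA : ∀ u v, H.Adj u v → u ∉ A → v ∈ A := fun u v huv hu => by
    rw [memA] at hu ⊢
    exact (hmin u v huv).resolve_left hu
  have hNB : ∀ v ∈ N, v ∉ B := by
    intro v hv hvB
    have h1 : (2 * (H.neighborFinset v ∩ A).card : ℝ) < d := by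
      exact_mod_cast (Finset.mem_filter.1 hv).2
    have h2 := (Finset.mem_filter.1 hvB).2
    have h3 : ((H.neighborFinset v ∩ N).card : ℝ) ≤ (H.neighborFinset v ∩ A).card := by
      exact_mod_cast Finset.card_le_card (Finset.inter_subset_inter_left hNA)
    nlinarith
  -- `Ns v` is the part of the neighbourhood whose colours matter. It leaves out `Big`, whose
  -- vertices would lie in too many events, and is cut down to `d ^ 2` vertices when `v` itself is
  -- in `Big`; both dependency bounds are then `d ^ 2`.
  have hNs : ∀ v, ∃ S : Finset V, S ⊆ H.neighborFinset v \ Big ∧ S.card ≤ d ^ 2 ∧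
      (H.degree v ≤ d ^ 2 → S = H.neighborFinset v \ Big) ∧
      (d ^ 2 < H.degree v → S.card = d ^ 2 ∧ S ⊆ A) := by
    intro v
    by_cases hv : H.degree v ≤ d ^ 2
    · refine ⟨_, subset_rfl, ?_, fun _ => rfl, fun h => absurd h hv.not_gt⟩
      exact (Finset.card_le_card Finset.sdiff_subset).trans ((hNcard v).le.trans hv)
    · push Not at hv
      obtain ⟨S, hS, hSc⟩ := Finset.exists_subset_card_eq (hv.le.trans (hNcard v).ge)
      have hSA : S ⊆ A := fun u hu => by
        refine hadjA v u ((H.mem_neighborFinset v u).1 (hS hu)) fun h => ?_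
        rw [memA] at h; omega
      exact ⟨S, fun u hu => Finset.mem_sdiff.2 ⟨hS hu, hABig u (hSA hu)⟩, hSc.le,
        fun h => absurd h hv.not_ge, fun _ => ⟨hSc, hSA⟩⟩
  choose Ns hNs1 hNs2 hNs3 hNs4 using hNs
  have hNsadj : ∀ v, ∀ u ∈ Ns v, H.Adj v u ∧ u ∉ Big := fun v u hu => by
    have := Finset.mem_sdiff.1 (hNs1 v hu)
    exact ⟨(H.mem_neighborFinset v u).1 this.1, this.2⟩
  have memNs : ∀ v u, H.degree v ≤ d ^ 2 → H.Adj v u → u ∉ Big → u ∈ Ns v := fun v u hv hvu hu => by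
    rw [hNs3 v hv, Finset.mem_sdiff, SimpleGraph.mem_neighborFinset]
    exact ⟨hvu, hu⟩
  have hNsdeg : ∀ v, (Ns v).card ≤ H.degree v := fun v =>
    (Finset.card_le_card ((hNs1 v).trans Finset.sdiff_subset)).trans (hNcard v).le
  obtain ⟨ω, hω⟩ := exists_balanced_colouring Ns
    (fun v => if v ∈ A then Ns v \ N else Ns v ∩ B) (fun v => Ns v ∩ A)
    (fun v => by
      split_ifs
      · exact Finset.sdiff_subset
      · exact Finset.inter_subset_left)
    (fun v => Finset.inter_subset_left) d ε p hd hp hpε hε hNs2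
    (fun u => by
      by_cases hu : u ∈ Big
      · rw [Finset.filter_eq_empty_iff.2 fun v _ h => (hNsadj v u h).2 hu]
        simp
      · rw [memBig, not_lt, ← hNcard] at hu
        refine (Finset.card_le_card fun v hv => ?_).trans hu
        rw [SimpleGraph.mem_neighborFinset]
        exact (hNsadj v u (Finset.mem_filter.1 hv).2).1.symm) h₁ h₂ h₃
  set X := Finset.univ.filter fun v => v ∉ N ∧ (v ∈ Big ∨ ω v = 1) with hX
  set F := A.filter fun v => ω v = 2 with hF
  have memX : ∀ v, v ∈ X ↔ v ∉ N ∧ (v ∈ Big ∨ ω v = 1) := fun v => by simp [hX]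
  have hAcol : ∀ u ∈ A, u ∈ F ∪ X → ω u ≠ 0 := by
    intro u hu huFX h0
    rcases Finset.mem_union.1 huFX with h | h
    · have := (Finset.mem_filter.1 h).2
      rw [h0] at this
      exact absurd this (by decide)
    · rcases ((memX u).1 h).2 with h | h
      · exact hABig u hu h
      · rw [h0] at h
        exact absurd h (by decide)
  have hcoloured : ∀ v, v ∉ Big → ∀ S : Finset V, S ⊆ A → S ⊆ H.neighborFinset v →
      (S.card : ℝ) - 6 * ε * H.degree v ≤ (S \ (F ∪ X)).card := by
    intro v hv S hSA hSv
    have hv' : H.degree v ≤ d ^ 2 := by rwa [memBig, not_lt] at hv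
    have h1 : S ⊆ (S \ (F ∪ X)) ∪ (Ns v).filter fun u => ω u ≠ 0 := by
      intro u hu
      by_cases huFX : u ∈ F ∪ X
      · refine Finset.mem_union_right _ (Finset.mem_filter.2 ⟨?_, hAcol u (hSA hu) huFX⟩)
        exact memNs v u hv' ((H.mem_neighborFinset v u).1 (hSv hu)) (hABig u (hSA hu))
      · exact Finset.mem_union_left _ (Finset.mem_sdiff.2 ⟨hu, huFX⟩)
    have h2 : (S.card : ℝ) ≤ (S \ (F ∪ X)).card + ((Ns v).filter fun u => ω u ≠ 0).card := by
      exact_mod_cast (Finset.card_le_card h1).trans (Finset.card_union_le _ _)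
    have h3 := (hω v).2.2.2
    have h4 : ((max d (Ns v).card : ℕ) : ℝ) ≤ H.degree v := by
      exact_mod_cast max_le (hdeg v) (hNsdeg v)
    have h5 : 6 * ε * (max d (Ns v).card : ℕ) ≤ 6 * ε * H.degree v := by gcongr
    linarith
  -- The weights are `ℓ` divided by a lower bound on `(Ns x ∩ F).card`: `ε / 4 * d ^ 2` for `x` in
  -- `Big`, and `ε / 4 * (d / 2)` for other centres, which have at least `d / 2` neighbours in `A`
  -- since they avoid `N`.
  let w : V → ℝ := fun x => if x ∈ Big then 4 * ℓ / (ε * d ^ 2) else 8 * ℓ / (ε * d)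
  have hFx : ∀ x, (Ns x ∩ A).filter (fun u => ω u = 2) = Ns x ∩ F := fun x => by
    ext u
    have hu : u ∈ F ↔ u ∈ A ∧ ω u = 2 := Finset.mem_filter
    rw [Finset.mem_inter, hu, Finset.mem_filter, ← and_assoc]
    exact and_congr_left fun _ => Finset.mem_inter
  obtain ⟨L, hL, hLd⟩ := exists_disjoint_subsets_of_weight X (fun x => Ns x ∩ F) ℓ w
    (by
      intro x hx
      obtain ⟨hxN, -⟩ := (memX x).1 hx
      have hω3 := (hω x).2.2.1
      simp only [hFx] at hω3
      by_cases hxB : x ∈ Big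
      · obtain ⟨hc, hsA⟩ := hNs4 x ((memBig x).1 hxB)
        rw [Finset.inter_eq_left.2 hsA, hc] at hω3
        push_cast at hω3
        have h1 := hω3 (by nlinarith)
        simp only [w, hxB, if_true]
        calc (ℓ : ℝ) = 4 * ℓ / (ε * d ^ 2) * (ε / 4 * d ^ 2) := by field_simp
          _ ≤ _ := by gcongr
      · have hxd : H.degree x ≤ d ^ 2 := by rwa [memBig, not_lt] at hxB
        have hNsA : Ns x ∩ A = H.neighborFinset x ∩ A := by
          ext u
          simp only [Finset.mem_inter, SimpleGraph.mem_neighborFinset]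
          exact ⟨fun h => ⟨(hNsadj x u h.1).1, h.2⟩, fun h => ⟨memNs x u hxd h.1 (hABig u h.2), h.2⟩⟩
        have h2 : (d : ℝ) / 2 ≤ (H.neighborFinset x ∩ A).card := by
          by_cases hxA : x ∈ A
          · have : ¬ 2 * (H.neighborFinset x ∩ A).card < d := fun h =>
              hxN (Finset.mem_filter.2 ⟨hxA, h⟩)
            have : (d : ℝ) ≤ 2 * (H.neighborFinset x ∩ A).card := by exact_mod_cast not_lt.1 this
            linarith
          · rw [Finset.inter_eq_left.2 fun u hu => hadjA x u ((H.mem_neighborFinset x u).1 hu) hxA,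
              hNcard]
            have : (d : ℝ) ≤ H.degree x := by exact_mod_cast hdeg x
            linarith
        rw [hNsA] at hω3
        have h1 := hω3 h2
        simp only [w, hxB, if_false]
        calc (ℓ : ℝ) = 8 * ℓ / (ε * d) * (ε / 4 * (d / 2)) := by field_simp; ring
          _ ≤ 8 * ℓ / (ε * d) * (ε / 4 * (H.neighborFinset x ∩ A).card) := by gcongr
          _ ≤ _ := by gcongr)
    (by
      intro f
      by_cases hf : f ∈ F
      swap
      · rw [Finset.filter_eq_empty_iff.2 fun x _ h => hf (Finset.mem_inter.1 h).2]
        simp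
      have hfA : f ∈ A := (Finset.mem_filter.1 hf).1
      have hfd : H.degree f = d := (memA f).1 hfA
      rw [← Finset.sum_filter_add_sum_filter_not _ (· ∈ Big)]
      -- A vertex of `F` has degree `d`, so it sees at most `d` centres in `Big`, and at most `3 * p
      -- * d` others, which all have colour 1.
      have hb1 : ((X.filter fun x => f ∈ Ns x ∩ F).filter (· ∈ Big)).card ≤ d := by
        rw [← hfd, ← hNcard]
        refine Finset.card_le_card fun x hx => ?_
        simp only [Finset.mem_filter, Finset.mem_inter] at hx
        rw [SimpleGraph.mem_neighborFinset]
        exact (hNsadj x f hx.1.2.1).1.symm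
      have hb2 : (((X.filter fun x => f ∈ Ns x ∩ F).filter (· ∉ Big)).card : ℝ) ≤ 3 * p * d := by
        refine le_trans ?_ ((hω f).2.1 ((hNsdeg f).trans hfd.le)).le
        refine Nat.cast_le.2 (Finset.card_le_card fun x hx => ?_)
        simp only [Finset.mem_filter, Finset.mem_inter] at hx
        obtain ⟨⟨hxX, hfx, -⟩, hxB⟩ := hx
        exact Finset.mem_filter.2 ⟨memNs f x (hfd.le.trans hdd.le) (hNsadj x f hfx).1.symm hxB,
          ((memX x).1 hxX).2.resolve_left hxB⟩
      have hs1 : ∑ x ∈ (X.filter fun x => f ∈ Ns x ∩ F).filter (· ∈ Big), w x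
          ≤ d * (4 * ℓ / (ε * d ^ 2)) := by
        rw [Finset.sum_congr rfl (g := fun _ => 4 * (ℓ : ℝ) / (ε * d ^ 2))
          fun x hx => by simp only [w, (Finset.mem_filter.1 hx).2, if_true],
          Finset.sum_const, nsmul_eq_mul]
        gcongr
      have hs2 : ∑ x ∈ (X.filter fun x => f ∈ Ns x ∩ F).filter (· ∉ Big), w x
          ≤ 3 * p * d * (8 * ℓ / (ε * d)) := by
        rw [Finset.sum_congr rfl (g := fun _ => 8 * (ℓ : ℝ) / (ε * d))
          fun x hx => by simp only [w, (Finset.mem_filter.1 hx).2, if_false],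
          Finset.sum_const, nsmul_eq_mul]
        gcongr
      have hs3 : d * (4 * ℓ / (ε * d ^ 2)) + 3 * p * d * (8 * ℓ / (ε * d))
          = (24 * p * d + 4) * ℓ / (ε * d) := by
        field_simp
        ring
      have hs4 : (24 * p * d + 4) * ℓ / (ε * d) ≤ 1 := (div_le_one (by positivity)).2 hload
      linarith)
  refine hasStarFactor_of_partial H X F (A \ B) ℓ ((1 - 7 * ε) * d) (by nlinarith) hℓ ?_ L ?_
    (fun x hx => (hL x hx).2) hLd ?_ ?_
  · rw [Finset.disjoint_left]
    intro v hvX hvF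
    obtain ⟨hvA, hv2⟩ := Finset.mem_filter.1 hvF
    rcases ((memX v).1 hvX).2 with h | h
    · exact hABig v hvA h
    · rw [hv2] at h
      exact absurd h (by decide)
  · intro x hx u hu
    have h := Finset.mem_inter.1 ((hL x hx).1 hu)
    exact Finset.mem_inter.2 ⟨(H.mem_neighborFinset x u).2 (hNsadj x u h.1).1, h.2⟩
  · intro v hv _
    obtain ⟨hvA, hvB⟩ := Finset.mem_sdiff.1 hv
    -- A neighbour in `Big` is already a centre. Otherwise `Ns v` is the whole neighbourhood, and as
    -- `v ∉ B` at least `ε * d` of it lies outside `N`, hence contains a vertex of colour 1.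
    by_cases hbig : ∃ x ∈ Big, H.Adj x v
    · obtain ⟨x, hx, hxv⟩ := hbig
      exact ⟨x, (memX x).2 ⟨fun h => hABig x (hNA x h) hx, Or.inl hx⟩, hxv⟩
    · push Not at hbig
      have hvd : H.degree v = d := (memA v).1 hvA
      have hsub : H.neighborFinset v \ N ⊆ Ns v \ N := by
        refine Finset.sdiff_subset_sdiff (fun u hu => ?_) subset_rfl
        rw [SimpleGraph.mem_neighborFinset] at hu
        exact memNs v u (hvd.le.trans hdd.le) hu fun h => hbig u h hu.symm
      have h1 : ((H.neighborFinset v ∩ N).card : ℝ) ≤ (1 - ε) * d := by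
        by_contra! h
        exact hvB (Finset.mem_filter.2 ⟨hvA, h⟩)
      have h2 : ((H.neighborFinset v \ N).card : ℝ) + (H.neighborFinset v ∩ N).card = d := by
        rw [← hvd, ← hNcard]
        exact_mod_cast Finset.card_sdiff_add_card_inter _ _
      have h3 : ((H.neighborFinset v \ N).card : ℝ) ≤ (Ns v \ N).card := by
        exact_mod_cast Finset.card_le_card hsub
      have h4 := (hω v).1
      simp only [hvA, if_true] at h4
      obtain ⟨u, hu, hu1⟩ := h4 (by linarith)
      obtain ⟨huN, huN'⟩ := Finset.mem_sdiff.1 hu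
      exact ⟨u, (memX u).2 ⟨huN', Or.inr hu1⟩, (hNsadj v u huN).1.symm⟩
  · intro v hvP hvX
    have hvBig : v ∉ Big := fun h => hvX ((memX v).2 ⟨fun h' => hABig v (hNA v h') h, Or.inl h⟩)
    have hvd2 : H.degree v ≤ d ^ 2 := by rwa [memBig, not_lt] at hvBig
    by_cases hvA : v ∈ A
    · right
      -- More than `(1 - ε) * d` neighbours lie in `N`, which is contained in `A \ B`; at most `6 *
      -- ε * d` of them are lost to `F ∪ X`.
      have hvB : v ∈ B := by
        by_contra h
        exact hvP (Finset.mem_sdiff.2 ⟨hvA, h⟩)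
      have h1 := (Finset.mem_filter.1 hvB).2
      have h2 := hcoloured v hvBig (H.neighborFinset v ∩ N)
        (fun u hu => hNA u (Finset.mem_inter.1 hu).2) Finset.inter_subset_left
      rw [(memA v).1 hvA] at h2
      have h3 : (((H.neighborFinset v ∩ N) \ (F ∪ X)).card : ℝ) ≤
          (H.neighborFinset v ∩ ((A \ B) \ (F ∪ X))).card := by
        refine Nat.cast_le.2 (Finset.card_le_card fun u hu => ?_)
        obtain ⟨hu1, hu2⟩ := Finset.mem_sdiff.1 hu
        obtain ⟨hu3, hu4⟩ := Finset.mem_inter.1 hu1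
        exact Finset.mem_inter.2 ⟨hu3, Finset.mem_sdiff.2
          ⟨Finset.mem_sdiff.2 ⟨hNA u hu4, hNB u hu4⟩, hu2⟩⟩
      linarith
    · have hvsub : ∀ u, H.Adj v u → u ∈ A := fun u hu => hadjA v u hu hvA
      have hT := (hω v).1
      simp only [hvA, if_false] at hT
      -- All neighbours of `v` lie in `A`. Either `B` contains enough of them to supply one of
      -- colour 1, which is a centre as `B` misses `N`, or nearly all lie in `A \ B`.
      by_cases hcB : ε * d ≤ (Ns v ∩ B).card
      · left
        obtain ⟨u, hu, hu1⟩ := hT hcB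
        obtain ⟨huN, huB⟩ := Finset.mem_inter.1 hu
        exact ⟨u, (memX u).2 ⟨fun h => hNB u h huB, Or.inr hu1⟩, (hNsadj v u huN).1.symm⟩
      · right
        push Not at hcB
        have h1 : H.neighborFinset v ⊆ (H.neighborFinset v ∩ (A \ B)) ∪ (Ns v ∩ B) := by
          intro u hu
          have hadj := (H.mem_neighborFinset v u).1 hu
          by_cases huB : u ∈ B
          · exact Finset.mem_union_right _ (Finset.mem_inter.2
              ⟨memNs v u hvd2 hadj (hABig u (hBA u huB)), huB⟩)
          · exact Finset.mem_union_left _ (Finset.mem_inter.2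
              ⟨hu, Finset.mem_sdiff.2 ⟨hvsub u hadj, huB⟩⟩)
        have h2 : (H.degree v : ℝ) ≤ (H.neighborFinset v ∩ (A \ B)).card + (Ns v ∩ B).card := by
          rw [← hNcard]
          exact_mod_cast (Finset.card_le_card h1).trans (Finset.card_union_le _ _)
        have h3 := hcoloured v hvBig (H.neighborFinset v ∩ (A \ B))
          (fun u hu => (Finset.mem_sdiff.1 (Finset.mem_inter.1 hu).2).1) Finset.inter_subset_left
        rw [Finset.inter_sdiff_assoc] at h3
        have h4 : (d : ℝ) ≤ H.degree v := by exact_mod_cast hdeg v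
        nlinarith

end Minimal

end StarFactor

/-! ### Choice of the parameters. -/

open Filter Topology in
theorem StarFactor.eventually_parameters : ∀ᶠ d : ℕ in atTop, ∀ x L ε p : ℝ,
    x = (d : ℝ) ^ (1 / 4 : ℝ) → L = Real.log d → ε = 32 * (Real.sqrt L / x) → p = 14 * L / (ε * d) →
    16 ≤ d ∧ 0 < p ∧ p ≤ ε ∧ 7 * ε < 1 ∧ Real.exp (-(p * ε * d / 2)) ≤ 1 / d ^ 5 ∧
      Real.exp (-(p * d)) ≤ 1 / d ^ 5 ∧ Real.exp (-(ε * d / 8)) ≤ 1 / d ^ 5 ∧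
      (24 * p * d + 4) * x ^ 2 ≤ ε * d ∧ 1 ≤ x * Real.sqrt L ∧ 0 < x ∧ x ^ 4 = d := by
  have hlog : Tendsto (fun d : ℕ => Real.sqrt (Real.log d) / (d : ℝ) ^ (1 / 4 : ℝ)) atTop (𝓝 0) := by
    have h1 := ((isLittleO_log_rpow_atTop (r := 1 / 2) (by norm_num)).tendsto_div_nhds_zero).comp
      (tendsto_natCast_atTop_atTop (R := ℝ))
    have h2 := (Real.continuous_sqrt.tendsto 0).comp h1
    rw [Real.sqrt_zero] at h2
    refine h2.congr fun d => ?_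
    have hd : (0 : ℝ) ≤ d := Nat.cast_nonneg d
    simp only [Function.comp]
    rw [Real.sqrt_div' _ (by positivity), Real.sqrt_eq_rpow ((d : ℝ) ^ _), ← Real.rpow_mul hd]
    norm_num
  have hlog1 : ∀ᶠ d : ℕ in atTop, (1 : ℝ) ≤ Real.log d :=
    (Real.tendsto_log_atTop.comp tendsto_natCast_atTop_atTop).eventually_ge_atTop 1
  filter_upwards [hlog.eventually_lt_const (show (0 : ℝ) < 1 / 400 by norm_num), hlog1,
    eventually_ge_atTop 16] with d hd1 hd2 hd3 x L ε p hx hL hε hp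
  rw [← hx, ← hL] at hd1
  rw [← hL] at hd2
  have hd0 : (16 : ℝ) ≤ d := by exact_mod_cast hd3
  have hx0 : 0 < x := hx ▸ Real.rpow_pos_of_pos (by linarith) _
  have hx4 : x ^ 4 = d := by
    rw [hx, ← Real.rpow_natCast, ← Real.rpow_mul (by linarith)]
    norm_num
  set s := Real.sqrt L with hs
  have hs2 : s ^ 2 = L := Real.sq_sqrt (by linarith)
  have hs1 : 1 ≤ s := Real.one_le_sqrt.2 hd2
  have hsx : 400 * s < x := by
    rw [div_lt_iff₀ hx0] at hd1
    linarith
  have hεx : ε * x = 32 * s := by rw [hε]; field_simp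
  have hε0 : 0 < ε := by rw [hε]; positivity
  have hεd : ε * d = 32 * s * x ^ 3 := by rw [← hx4, ← hεx]; ring
  have hpεd : p * (ε * d) = 14 * L := by
    rw [hp]
    field_simp
  have hp0 : 0 < p := by rw [hp]; positivity
  have hpd : p * d * (32 * s) = 14 * s ^ 2 * x := by
    rw [← hεx, hs2, ← hpεd]; ring
  have hpd' : p * d = 7 / 16 * s * x := by
    have : (p * d - 7 / 16 * s * x) * (32 * s) = 0 := by rw [sub_mul, hpd]; ring
    rcases mul_eq_zero.1 this with h | h
    · linarith
    · linarith
  -- The failure bound `1 / d ^ 5` only needs exponents of at least `5 * log d`; the constants 14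
  -- and 32 in `p` and `ε` secure this.
  have hexp : ∀ y : ℝ, 5 * L ≤ y → Real.exp (-y) ≤ 1 / d ^ 5 := by
    intro y hy
    have h1 : Real.exp (5 * L) = (d : ℝ) ^ 5 := by
      have := Real.exp_nat_mul L 5
      push_cast at this
      rw [this, hL, Real.exp_log (by linarith)]
    rw [Real.exp_neg, ← one_div, ← h1]
    exact one_div_le_one_div_of_le (Real.exp_pos _) (Real.exp_le_exp.2 hy)
  have hx1 : 400 ≤ x := by linarith
  have hsx2 : s ^ 2 ≤ s * x := by nlinarith
  have hx3 : x ≤ x ^ 3 := by nlinarith [sq_nonneg x]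
  refine ⟨hd3, hp0, ?_, ?_, hexp _ ?_, hexp _ ?_, hexp _ ?_, ?_, ?_, hx0, hx4⟩
  · have h1 : p * d ≤ ε * d := by
      rw [hpd', hεd]
      nlinarith
    exact le_of_mul_le_mul_right h1 (by linarith)
  · rw [hε]; linarith
  · have : p * ε * d / 2 = 7 * L := by rw [mul_assoc, hpεd]; ring
    linarith
  · rw [hpd', ← hs2]
    nlinarith
  · rw [hεd, ← hs2]
    have : s * x ≤ s * x ^ 3 := by gcongr
    nlinarith
  · rw [hεd, mul_assoc 24 p, hpd']
    have : 4 ≤ s * x := by nlinarith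
    nlinarith [mul_le_mul_of_nonneg_right this (sq_nonneg x)]
  · nlinarith

theorem theorem1 :
    ∃ d₀ C : ℕ, ∀ (V : Type*) [Fintype V] (G : SimpleGraph V) [DecidableRel G.Adj] (d : ℕ),
      G.minDegree = d → d₀ ≤ d →
        ∃ ℓ : ℕ,
          Real.sqrt (d : ℝ) - (C : ℝ) * (d : ℝ) ^ (1 / 4 : ℝ) * Real.sqrt (Real.log (d : ℝ)) ≤ (ℓ : ℝ) ∧
            StarFactor.HasStarFactor G ℓ := by
  obtain ⟨d₀, hd₀⟩ := Filter.eventually_atTop.1 StarFactor.eventually_parameters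
  -- `225 = 7 * 32 + 1`: the loss `7 * ε * x ^ 2` equals `224 * x * s`, and rounding down costs less
  -- than `1 ≤ x * s`.
  refine ⟨d₀, 225, fun V _ G _ d hGd hd => ?_⟩
  classical
  obtain ⟨h16, hp, hpε, hε, h₁, h₂, h₃, hload, hone, hx, hx4⟩ := hd₀ d hd _ _ _ _ rfl rfl rfl rfl
  obtain ⟨H, _, hHG, hdeg, hmin⟩ := StarFactor.exists_edge_minimal G d
    fun v => hGd ▸ G.minDegree_le_degree v
  set x := (d : ℝ) ^ (1 / 4 : ℝ) with hxdef
  set s := Real.sqrt (Real.log d) with hs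
  set ε := 32 * (s / x) with hεdef
  set p := 14 * Real.log d / (ε * d) with hpdef
  have hεx : ε * x ^ 2 = 32 * (x * s) := by rw [hεdef]; field_simp
  have hsq : Real.sqrt d = x ^ 2 := by
    rw [← hx4, show x ^ 4 = (x ^ 2) ^ 2 by ring, Real.sqrt_sq (by positivity)]
  have h0 : 0 ≤ (1 - 7 * ε) * x ^ 2 := mul_nonneg (by linarith) (by positivity)
  have hfl := Nat.floor_le h0
  have hfl' := Nat.lt_floor_add_one ((1 - 7 * ε) * x ^ 2)
  refine ⟨⌊(1 - 7 * ε) * x ^ 2⌋₊, ?_, (StarFactor.hasStarFactor_of_edge_minimal H d _ ε p h16 hdeg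
    hmin hp hpε hε h₁ h₂ h₃ ?_ ?_).mono hHG⟩
  · rw [hsq]
    push_cast
    nlinarith
  · refine le_trans (mul_le_mul_of_nonneg_left (hfl.trans ?_) (by positivity)) hload
    exact mul_le_of_le_one_left (by positivity) (by linarith)
  · calc _ ≤ ((1 - 7 * ε) * x ^ 2) * ((1 - 7 * ε) * x ^ 2) :=
          mul_le_mul hfl hfl (Nat.cast_nonneg _) h0
      _ = (1 - 7 * ε) * ((1 - 7 * ε) * x ^ 4) := by ring
      _ ≤ 1 * ((1 - 7 * ε) * x ^ 4) := by
          refine mul_le_mul_of_nonneg_right (by linarith) (mul_nonneg (by linarith) (by positivity))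
      _ = _ := by rw [one_mul, hx4]
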